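/- Let $k$ be a field of characteristic $0$, let $n,m\ge 0$, and let $L=k\langle y\rangle=k\langle y^1,\dots,y^m\rangle$ be the field of rational functions over $k$ in the jet coordinates $y^l_\mu$ ($1\le l\le m$, $\mu\in\mathbb N^n$), with the $n$ commuting formal derivatives $d_i$ that kill $k$ and satisfy $d_iy^l_\mu=y^l_{\mu+1_i}$. For $0\le q\le\infty$ let $L_q=k(y^l_\mu:|\mu|\le q)$, so that $L_0=k(y)$ and $L_\infty=L$. Let $\Phi,\Psi$ be families of elements of $L$ and put $$k\subset K=k\langle\Phi\rangle\subset K'=k\langle\Phi,\Psi\rangle\subset L ,$$ so that $K'$ may be any intermediate differential field between $K$ and $L$. Let $\Gamma$ (resp. $\Gamma'$) be the pseudogroup of invertible target transformations $\bar y=g(y)$ preserving every element of $\Phi$ (resp. of $\Phi$ and $\Psi$). It is given by its finite Lie equations: the points of $\Gamma$ over the generic point $y$, with values in a commutative $L$-algebra $A$, are the jets $(g^l_\nu)$, $\nu\in\mathbb N^m$ (standing for $\partial_\nu g^l$), with invertible Jacobian matrix, whose prolongation $y^l_\mu\mapsto\bar y^l_\mu$, where $\bar y^l_\mu$ is $d_\mu(g^l(y))$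 expanded by the chain rule, extends to a $k$-algebra homomorphism $L\to A$ fixing $\Phi$ and all the $d_\mu\Phi$; similarly for $\Gamma'$. Linearizing at the identity, let $R(\Gamma)$ be the set of sections $\eta=(\eta^l_\nu)$, with components in $k(y)$, for which $\mathrm{id}+\varepsilon\eta$ is a point of $\Gamma$ over $L[\varepsilon]$, $\varepsilon^2=0$. Each $\eta$ defines the $k$-derivation $\sharp(\eta)$ of $L$ that sends $y^l_\mu$ to $d_\mu\eta^l$ with the derivatives $\partial_\nu\eta^l$ replaced by $\eta^l_\nu$; it maps every $L_q$ into itself. Let $\Theta=\{\sharp(\eta):\eta\in R(\Gamma)\}$ and let $\Theta'$ be defined in the same way from $\Gamma'$. An element of $L$ is a differential invariant of $\Gamma'$ if it is killed by every $\theta'\in\Theta'$. For $0\le q\le\infty$ the reciprocal distribution $\Delta(q)$ is the set of the $k$-derivations $\delta$ of $L_q$ such that $[\theta,\delta]=0$ on $L_q$ for all $\theta\in\Theta$. Call an intermediate field $F$ stable under $\Delta$ if $\delta(F\cap L_q)\subset F$ for all $q$ and all $\delta\in\Delta(q)$. Then: 1. $\Gamma'\subset\Gamma$, that is, every point of $\Gamma'$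 is a point of $\Gamma$. 2. For all $0\le q\le\infty$ and all $\delta\in\Delta(q)$, $\delta$ maps every element of $K'\cap L_q$, in particular every $\Psi$ of order at most $q$, to a differential invariant of $\Gamma'$. 3. Only stable intermediate differential fields can occur in a differential Galois correspondence with subpseudogroups of $\Gamma$: if $K'$ is exactly the field of the elements of $L$ killed by $\sharp(\eta)$ for all $\eta$ in some subset of $R(\Gamma)$ (for example the infinitesimal transformations of a subpseudogroup of $\Gamma$, such as $\Gamma'$ itself), then $K'$ is stable under $\Delta$. -/

import Mathlib

open scoped DualNumber

noncomputable section

namespace JetGalois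

universe u

/-- The differential field `L = k<y>` (as a field): rational functions over `k` in the jet
coordinates `y^l_μ`, with `l` among the `m` unknowns and `μ` a multi-index in the `n`
independent variables. -/
abbrev JetField (k : Type u) [Field k] (n m : ℕ) : Type u :=
  FractionRing (MvPolynomial (Fin m × (Fin n →₀ ℕ)) k)

section

variable (k : Type u) [Field k] (n m : ℕ)

/-- The jet coordinate `y^l_μ`. -/
def jet (l : Fin m) (μ : Fin n →₀ ℕ) : JetField k n m :=
  algebraMap (MvPolynomial (Fin m × (Fin n →₀ ℕ)) k) _ (MvPolynomial.X (l, μ))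

variable {k n m}

/-- The homomorphism `P ↦ P + ε D P` on polynomials, where `D` sends `y^l_μ` to `v l μ`. -/
def firstOrderPoly (v : Fin m → (Fin n →₀ ℕ) → JetField k n m) :
    MvPolynomial (Fin m × (Fin n →₀ ℕ)) k →ₐ[k] (JetField k n m)[ε] :=
  MvPolynomial.aeval fun x =>
    TrivSqZeroExt.inl (jet k n m x.1 x.2) + TrivSqZeroExt.inr (v x.1 x.2)

theorem fst_firstOrderPoly (v : Fin m → (Fin n →₀ ℕ) → JetField k n m)
    (p : MvPolynomial (Fin m × (Fin n →₀ ℕ)) k) :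
    (firstOrderPoly v p).fst = algebraMap _ (JetField k n m) p := by
  have h : (TrivSqZeroExt.fstHom k (JetField k n m) (JetField k n m)).comp (firstOrderPoly v)
      = IsScalarTower.toAlgHom k _ (JetField k n m) := by
    ext x
    simp [firstOrderPoly, jet]
  exact DFunLike.congr_fun h p

/-- The homomorphism `a ↦ a + ε D a` on the jet field. -/
def firstOrder (v : Fin m → (Fin n →₀ ℕ) → JetField k n m) :
    JetField k n m →ₐ[k] (JetField k n m)[ε] :=
  IsLocalization.liftAlgHom
    (M := nonZeroDivisors (MvPolynomial (Fin m × (Fin n →₀ ℕ)) k)) (f := firstOrderPoly v)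
    (by
      intro p
      rw [TrivSqZeroExt.isUnit_iff_isUnit_fst, fst_firstOrderPoly]
      exact IsLocalization.map_units (JetField k n m) p)

theorem firstOrder_algebraMap (v : Fin m → (Fin n →₀ ℕ) → JetField k n m)
    (p : MvPolynomial (Fin m × (Fin n →₀ ℕ)) k) :
    firstOrder v (algebraMap _ (JetField k n m) p) = firstOrderPoly v p := by
  simp [firstOrder]

theorem fst_firstOrder (v : Fin m → (Fin n →₀ ℕ) → JetField k n m) (a : JetField k n m) :
    (firstOrder v a).fst = a := by
  have h : (TrivSqZeroExt.fstHom k (JetField k n m) (JetField k n m)).comp (firstOrder v)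
      = AlgHom.id k (JetField k n m) := by
    refine IsLocalization.algHom_ext
      (nonZeroDivisors (MvPolynomial (Fin m × (Fin n →₀ ℕ)) k)) ?_
    refine AlgHom.ext fun p => ?_
    exact (congrArg TrivSqZeroExt.fst (firstOrder_algebraMap v p)).trans (fst_firstOrderPoly v p)
  exact DFunLike.congr_fun h a

/-- The `k`-derivation of the jet field with prescribed values on the jet coordinates. -/
def derivOfValues (v : Fin m → (Fin n →₀ ℕ) → JetField k n m) :
    Derivation k (JetField k n m) (JetField k n m) :=
  Derivation.mk'
    ((TrivSqZeroExt.sndHom (JetField k n m) (JetField k n m)).restrictScalars k ∘ₗ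
      (firstOrder v).toLinearMap)
    (by
      intro a b
      simp [fst_firstOrder, mul_comm])

theorem derivOfValues_jet (v : Fin m → (Fin n →₀ ℕ) → JetField k n m)
    (l : Fin m) (μ : Fin n →₀ ℕ) : derivOfValues v (jet k n m l μ) = v l μ := by
  simp [derivOfValues, jet, firstOrder_algebraMap, firstOrderPoly]

/-- The formal derivative `d_i` on `L`: it kills `k` and sends `y^l_μ` to `y^l_{μ+1_i}`. -/
def formalDeriv (i : Fin n) : Derivation k (JetField k n m) (JetField k n m) :=
  derivOfValues fun l μ => jet k n m l (μ + Finsupp.single i 1)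

/-- The multi-index `μ` written as a list of `|μ|` directions. -/
def directions (μ : Fin n →₀ ℕ) : List (Fin n) :=
  (List.finRange n).flatMap fun i => List.replicate (μ i) i

/-- The iterated formal derivative `d_μ` on `L`. -/
def formalDerivIter (μ : Fin n →₀ ℕ) (a : JetField k n m) : JetField k n m :=
  (directions μ).foldr (fun i b => formalDeriv i b) a

/-- The differential field `k<S>` inside `L`. -/
def diffAdjoin (S : Set (JetField k n m)) : IntermediateField k (JetField k n m) :=
  IntermediateField.adjoin k {a | ∃ s ∈ S, ∃ μ : Fin n →₀ ℕ, a = formalDerivIter μ s}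

variable (k n m) in
/-- The field `L_q` of differential functions of order at most `q ≤ ∞`. In particular
`L_0 = k(y)` and `L_∞ = L`. -/
def level (q : ℕ∞) : IntermediateField k (JetField k n m) :=
  IntermediateField.adjoin k
    {a | ∃ (l : Fin m) (μ : Fin n →₀ ℕ), (μ.degree : ℕ∞) ≤ q ∧ a = jet k n m l μ}

/-- The formal derivative `d_i` of a function `∑_ν c_ν(y_q) ∂_ν g` when `g = g(y)` is an unknown
function of `y`, by the chain rule: the coefficient vector of
`∑_ν (d_i c_ν) ∂_ν g + ∑_ν ∑_r c_ν y^r_i ∂_{ν+1_r} g`. -/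
def chainRule (i : Fin n) (c : (Fin m →₀ ℕ) →₀ JetField k n m) :
    (Fin m →₀ ℕ) →₀ JetField k n m :=
  c.mapRange (formalDeriv i) (map_zero _) +
    c.sum fun ν a => ∑ r : Fin m,
      Finsupp.single (ν + Finsupp.single r 1) (a * jet k n m r (Finsupp.single i 1))

variable (k m) in
/-- The coefficients `c_{μ,ν}` in `d_μ (g(y)) = ∑_ν c_{μ,ν} ∂_ν g`. -/
def prolongCoeff (μ : Fin n →₀ ℕ) : (Fin m →₀ ℕ) →₀ JetField k n m :=
  (directions μ).foldr (fun i c => chainRule i c) (Finsupp.single 0 1)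

variable (k) in
/-- Composition of the generic jet `(y^l_μ)` with a target jet: `g l ν` stands for the derivative
`∂_ν g^l` at the generic point `y`, with values in a commutative `L`-algebra `A`, and
the result is the family of the `d_μ (g^l(y))`. -/
def prolong {A : Type*} [CommRing A] [Algebra (JetField k n m) A]
    (g : Fin m → (Fin m →₀ ℕ) → A) (l : Fin m) (μ : Fin n →₀ ℕ) : A :=
  (prolongCoeff k m μ).sum fun ν a => a • g l ν

/-- The `A`-points, over the generic point `y`, of the pseudogroup of all invertible target
transformations `ȳ = g(y)` preserving each element of `S`: the jets `g` with invertible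
Jacobian matrix whose prolongation `y^l_μ ↦ ȳ^l_μ` is defined on `L` and satisfies the finite
Lie equations `s(ȳ_q) = s(y_q)`, `s ∈ S`, together with all their prolongations. -/
def pseudogroup (S : Set (JetField k n m)) (A : Type*) [CommRing A] [Algebra k A]
    [Algebra (JetField k n m) A] [IsScalarTower k (JetField k n m) A] :
    Set (Fin m → (Fin m →₀ ℕ) → A) :=
  {g | IsUnit (Matrix.of fun l r : Fin m => g l (Finsupp.single r 1)).det ∧
    ∃ φ : JetField k n m →ₐ[k] A, (∀ l μ, φ (jet k n m l μ) = prolong k g l μ) ∧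
      ∀ s ∈ S, ∀ μ : Fin n →₀ ℕ,
        φ (formalDerivIter μ s) = algebraMap (JetField k n m) A (formalDerivIter μ s)}

variable (k n m) in
/-- The jet of the identity transformation `g(y) = y` at the generic point. -/
def identityJet (l : Fin m) (ν : Fin m →₀ ℕ) : JetField k n m :=
  if ν = 0 then jet k n m l 0 else if ν = Finsupp.single l 1 then 1 else 0

variable (k n m) in
/-- Sections `η = (η^l_ν)` over the target of the infinite jet bundle of the tangent bundle of the
target, with coefficients in `k(y)`. -/
abbrev TargetSection : Type u := Fin m → (Fin m →₀ ℕ) → level k n m 0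

/-- The sections `R(S)` of the infinitesimal Lie equations of the pseudogroup preserving `S`,
that is, of the linearization at the identity of the finite Lie equations: `id + ε η` is a
point of the pseudogroup over the dual numbers. -/
def infinitesimal (S : Set (JetField k n m)) : Set (TargetSection k n m) :=
  {η | (fun l ν => (TrivSqZeroExt.inl (identityJet k n m l ν) +
      TrivSqZeroExt.inr (η l ν : JetField k n m) : (JetField k n m)[ε])) ∈
        pseudogroup S (JetField k n m)[ε]}

/-- The vertical derivation `♯(η)` of `L`: it sends `y^l_μ` to `d_μ η^l`, in which the
derivatives `∂_ν η^l` are replaced by the components `η^l_ν`. -/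
def sharp (η : TargetSection k n m) : Derivation k (JetField k n m) (JetField k n m) :=
  derivOfValues (prolong k fun l ν => (η l ν : JetField k n m))

/-- The elements of `L` killed by all the infinitesimal transformations `♯(η)`, `η ∈ R`. -/
def invariants (R : Set (TargetSection k n m)) : Set (JetField k n m) :=
  {a | ∀ η ∈ R, sharp η a = 0}

theorem jet_mem_level {q : ℕ∞} (l : Fin m) (μ : Fin n →₀ ℕ) (h : (μ.degree : ℕ∞) ≤ q) :
    jet k n m l μ ∈ level k n m q :=
  IntermediateField.subset_adjoin k _ ⟨l, μ, h, rfl⟩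

theorem level_mono {p q : ℕ∞} (h : p ≤ q) : level k n m p ≤ level k n m q := by
  refine IntermediateField.adjoin.mono k _ _ ?_
  rintro a ⟨l, μ, hμ, rfl⟩
  exact ⟨l, μ, hμ.trans h, rfl⟩

theorem derivation_mem {p q : ℕ∞} (hpq : p ≤ q)
    (D : Derivation k (JetField k n m) (JetField k n m))
    (hD : ∀ (l : Fin m) (μ : Fin n →₀ ℕ), (μ.degree : ℕ∞) ≤ p →
      D (jet k n m l μ) ∈ level k n m q)
    {a : JetField k n m} (ha : a ∈ level k n m p) : D a ∈ level k n m q := by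
  have up : ∀ {b}, b ∈ level k n m p → b ∈ level k n m q := fun h => level_mono hpq h
  refine IntermediateField.adjoin_induction k (p := fun x _ => D x ∈ level k n m q)
    ?_ ?_ ?_ ?_ ?_ ha
  · rintro x ⟨l, μ, hμ, rfl⟩
    exact hD l μ hμ
  · intro x
    simp
  · intro x y _ _ hx hy
    rw [map_add]
    exact add_mem hx hy
  · intro x hx h
    rw [Derivation.leibniz_inv, smul_eq_mul]
    exact mul_mem (neg_mem (pow_mem (inv_mem (up hx)) 2)) h
  · intro x y hx hy h h'
    rw [Derivation.leibniz, smul_eq_mul, smul_eq_mul]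
    exact add_mem (mul_mem (up hx) h') (mul_mem (up hy) h)

theorem chainRule_mem {p : ℕ} (i : Fin n) (c : (Fin m →₀ ℕ) →₀ JetField k n m)
    (hc : ∀ ν, c ν ∈ level k n m (p : ℕ∞)) (ν : Fin m →₀ ℕ) :
    chainRule i c ν ∈ level k n m ((p + 1 : ℕ) : ℕ∞) := by
  have hle : (p : ℕ∞) ≤ ((p + 1 : ℕ) : ℕ∞) := by exact_mod_cast Nat.le_succ p
  rw [chainRule, Finsupp.add_apply, Finsupp.mapRange_apply, Finsupp.sum, Finsupp.finsetSum_apply]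
  refine add_mem (derivation_mem hle _ ?_ (hc ν)) (sum_mem fun ν' _ => ?_)
  · intro l μ hμ
    rw [formalDeriv, derivOfValues_jet]
    refine jet_mem_level l _ ?_
    rw [map_add, Finsupp.degree_single]
    exact_mod_cast Nat.succ_le_succ (by exact_mod_cast hμ)
  · rw [Finsupp.finsetSum_apply]
    refine sum_mem fun r _ => ?_
    rw [Finsupp.single_apply]
    split_ifs
    · refine mul_mem (level_mono hle (hc ν')) (jet_mem_level r _ ?_)
      rw [Finsupp.degree_single]
      exact_mod_cast Nat.le_add_left 1 p
    · exact zero_mem _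

theorem length_directions (μ : Fin n →₀ ℕ) : (directions μ).length = μ.degree := by
  rw [directions, List.length_flatMap, Finsupp.degree_eq_sum]
  simp [← List.ofFn_eq_map, List.sum_ofFn]

theorem prolongCoeff_mem (μ : Fin n →₀ ℕ) (ν : Fin m →₀ ℕ) :
    prolongCoeff k m μ ν ∈ level k n m (μ.degree : ℕ∞) := by
  rw [prolongCoeff, ← length_directions]
  induction directions μ generalizing ν with
  | nil =>
    rw [List.foldr_nil, Finsupp.single_apply]
    split_ifs
    · exact one_mem _
    · exact zero_mem _
  | cons i t ih => exact chainRule_mem i _ ih ν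

/-- `♯(η)` does not raise the order. -/
theorem sharp_mem (η : TargetSection k n m) (q : ℕ∞) {a : JetField k n m}
    (ha : a ∈ level k n m q) : sharp η a ∈ level k n m q := by
  refine derivation_mem le_rfl _ ?_ ha
  intro l μ hμ
  rw [sharp, derivOfValues_jet, prolong, Finsupp.sum]
  refine sum_mem fun ν _ => ?_
  rw [smul_eq_mul]
  exact mul_mem (level_mono hμ (prolongCoeff_mem μ ν)) (level_mono zero_le (η l ν).2)

/-- The derivation `♯(η)` on the field of differential functions of order at most `q`. -/
def sharpAt (q : ℕ∞) (η : TargetSection k n m) :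
    Derivation k (level k n m q) (level k n m q) :=
  Derivation.mk'
    { toFun := fun a => ⟨sharp η a, sharp_mem η q a.2⟩
      map_add' := fun a b => Subtype.ext (map_add (sharp η) (a : JetField k n m) b)
      map_smul' := fun c a => Subtype.ext ((sharp η).map_smul c (a : JetField k n m)) }
    (fun a b => Subtype.ext ((sharp η).leibniz (a : JetField k n m) b))

/-- The reciprocal distribution `Δ(q)`, `q ≤ ∞`: the derivations on differential functions of
order at most `q` that commute with every `♯(η)`, `η ∈ R`. -/
def reciprocal (R : Set (TargetSection k n m)) (q : ℕ∞) :
    Set (Derivation k (level k n m q) (level k n m q)) :=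
  {δ | ∀ η ∈ R, ⁅sharpAt q η, δ⁆ = 0}

/-- A subfield of `L` is stable under the reciprocal distribution of `R`. -/
def IsStable (R : Set (TargetSection k n m)) (F : IntermediateField k (JetField k n m)) : Prop :=
  ∀ q : ℕ∞, ∀ δ ∈ reciprocal R q, ∀ a : level k n m q,
    (a : JetField k n m) ∈ F → (δ a : JetField k n m) ∈ F

end

end JetGalois

end

/-!
Everything follows from two facts. First, enlarging the family of preserved functions adds
conditions to the finite Lie equations, so `Γ' ⊆ Γ`, and linearizing gives `R(Γ') ⊆ R(Γ)`.
Second, `♯(η)` kills `k⟨S⟩` whenever `η ∈ R(S)`: the homomorphism `L → L[ε]` belonging to the point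
`id + ε η` sends `y^l_μ` to `y^l_μ + ε d_μ η^l`, because the identity jet prolongs to the identity
(`prolong_identityJet`), so it is `a ↦ a + ε ♯(η) a`, and fixing `d_μ s` means that `♯(η)` kills
`d_μ s`. The kernel of a derivation is a field, so all of `k⟨S⟩` is killed
(`sharp_eq_zero_of_mem_diffAdjoin`).

Now let `δ` commute with `♯(η)`. If `♯(η) a = 0`, then `♯(η) (δ a) = δ (♯(η) a) = 0`: the elements
killed by `♯(η)` are mapped to elements killed by `♯(η)`. With `η ∈ R(Γ')` this is the second claim,
and with `η` in the given subset of `R(Γ)` it is the third.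
-/

namespace JetGalois

variable {k : Type*} [Field k] {n m : ℕ}

theorem pseudogroup_anti {S T : Set (JetField k n m)} (h : S ⊆ T) (A : Type*) [CommRing A]
    [Algebra k A] [Algebra (JetField k n m) A] [IsScalarTower k (JetField k n m) A] :
    pseudogroup T A ⊆ pseudogroup S A := by
  rintro g ⟨hg, φ, hφ, hfix⟩
  exact ⟨hg, φ, hφ, fun s hs => hfix s (h hs)⟩

theorem infinitesimal_anti {S T : Set (JetField k n m)} (h : S ⊆ T) :
    infinitesimal T ⊆ infinitesimal S := by
  rintro η ⟨hη, φ, hφ, hfix⟩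
  exact ⟨hη, φ, hφ, fun s hs => hfix s (h hs)⟩

/-- The identity jet is the jet of an actual transformation: its components satisfy the chain
rule `d_i (∂_ν g) = ∑_r y^r_i ∂_{ν+1_r} g`. -/
theorem formalDeriv_identityJet (i : Fin n) (l : Fin m) (ν : Fin m →₀ ℕ) :
    formalDeriv i (identityJet k n m l ν) =
      ∑ r : Fin m, jet k n m r (Finsupp.single i 1) *
        identityJet k n m l (ν + Finsupp.single r 1) := by
  have hne : ∀ r : Fin m, ν + Finsupp.single r 1 ≠ 0 := fun r h => by
    simpa using DFunLike.congr_fun h r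
  by_cases hν : ν = 0
  · subst hν
    simp [identityJet, formalDeriv, derivOfValues_jet, Finsupp.single_left_inj]
  · have hne' : ∀ r : Fin m, ν + Finsupp.single r 1 ≠ Finsupp.single l 1 := fun r h => by
      have hdeg := congrArg Finsupp.degree h
      rw [map_add, Finsupp.degree_single, Finsupp.degree_single, Nat.add_eq_right,
        Finsupp.degree_eq_zero_iff] at hdeg
      exact hν hdeg
    have hz : formalDeriv i (identityJet k n m l ν) = 0 := by
      rw [identityJet, if_neg hν]
      split_ifs <;> simp
    rw [hz]
    simp [identityJet, hne, hne']

/-- `chainRule i` computes `d_i` of a combination of the derivatives of the identity. -/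
theorem sum_chainRule_identityJet (i : Fin n) (l : Fin m)
    (c : (Fin m →₀ ℕ) →₀ JetField k n m) :
    ((chainRule i c).sum fun ν a => a * identityJet k n m l ν) =
      formalDeriv i (c.sum fun ν a => a * identityJet k n m l ν) := by
  have hsum : ∀ f g : (Fin m →₀ ℕ) →₀ JetField k n m,
      ((f + g).sum fun ν a => a * identityJet k n m l ν) =
        (f.sum fun ν a => a * identityJet k n m l ν) +
          g.sum fun ν a => a * identityJet k n m l ν := fun f g =>
    Finsupp.sum_add_index' (fun _ => zero_mul _) (fun _ _ _ => add_mul _ _ _)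
  have hfin : ∀ (a : JetField k n m) (ν : Fin m →₀ ℕ),
      ((∑ r : Fin m, Finsupp.single (ν + Finsupp.single r 1)
        (a * jet k n m r (Finsupp.single i 1))).sum fun ν a => a * identityJet k n m l ν) =
      a * formalDeriv i (identityJet k n m l ν) := fun a ν => by
    rw [← Finsupp.sum_finsetSum_index (fun _ => zero_mul _) (fun _ _ _ => add_mul _ _ _),
      formalDeriv_identityJet, Finset.mul_sum]
    refine Finset.sum_congr rfl fun r _ => ?_
    rw [Finsupp.sum_single_index (zero_mul _), mul_assoc]
  rw [chainRule, hsum, Finsupp.sum_mapRange_index (fun _ => zero_mul _),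
    Finsupp.sum_sum_index (fun _ => zero_mul _) (fun _ _ _ => add_mul _ _ _)]
  simp only [hfin]
  rw [Finsupp.sum, Finsupp.sum, Finsupp.sum, map_sum, ← Finset.sum_add_distrib]
  refine Finset.sum_congr rfl fun ν _ => ?_
  rw [Derivation.leibniz, smul_eq_mul, smul_eq_mul]
  ring

theorem formalDerivIter_jet (l : Fin m) (μ : Fin n →₀ ℕ) :
    formalDerivIter μ (jet k n m l 0) = jet k n m l μ := by
  have h : ∀ t : List (Fin n), t.foldr (fun i b => formalDeriv i b) (jet k n m l 0) =
      jet k n m l (t.map fun i => Finsupp.single i 1).sum := fun t => by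
    induction t with
    | nil => rfl
    | cons i t ih =>
      rw [List.foldr_cons, ih, formalDeriv, derivOfValues_jet, List.map_cons, List.sum_cons,
        add_comm]
  rw [formalDerivIter, h]
  congr 1
  rw [directions, List.map_flatMap, List.flatMap_def, List.sum_flatten, List.map_map]
  simp only [Function.comp_def, List.map_replicate, List.sum_replicate, Finsupp.smul_single, smul_eq_mul, mul_one]
  rw [← List.ofFn_eq_map, List.sum_ofFn]
  exact Finsupp.univ_sum_single μ

/-- The identity jet prolongs to the identity of `L`. -/
theorem prolong_identityJet (l : Fin m) (μ : Fin n →₀ ℕ) :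
    prolong k (identityJet k n m) l μ = jet k n m l μ := by
  rw [← formalDerivIter_jet, formalDerivIter, prolong, prolongCoeff]
  simp only [smul_eq_mul]
  induction directions μ with
  | nil => simp [identityJet]
  | cons i t ih => rw [List.foldr_cons, sum_chainRule_identityJet, ih, List.foldr_cons]

/-- The homomorphism `L → L[ε]` belonging to the point `id + ε η` is `a ↦ a + ε ♯(η) a`. -/
theorem algHom_eq_firstOrder (η : TargetSection k n m)
    (φ : JetField k n m →ₐ[k] (JetField k n m)[ε])
    (hφ : ∀ l μ, φ (jet k n m l μ) =
      prolong k (fun l ν => (TrivSqZeroExt.inl (identityJet k n m l ν) +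
        TrivSqZeroExt.inr (η l ν : JetField k n m) : (JetField k n m)[ε])) l μ) :
    φ = firstOrder (prolong k fun l ν => (η l ν : JetField k n m)) := by
  refine IsLocalization.algHom_ext
    (nonZeroDivisors (MvPolynomial (Fin m × (Fin n →₀ ℕ)) k)) ?_
  refine MvPolynomial.algHom_ext fun x => ?_
  refine (hφ x.1 x.2).trans (Eq.trans ?_ (firstOrder_algebraMap _ (MvPolynomial.X x)).symm)
  rw [firstOrderPoly, MvPolynomial.aeval_X]
  conv_rhs => rw [← prolong_identityJet]
  simp only [prolong, Finsupp.sum]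
  ext <;> simp [TrivSqZeroExt.fst_sum, TrivSqZeroExt.snd_sum]

/-- The infinitesimal transformations preserving `S` kill the differential field `k⟨S⟩`. -/
theorem sharp_eq_zero_of_mem_diffAdjoin {S : Set (JetField k n m)} {η : TargetSection k n m}
    (hη : η ∈ infinitesimal S) {a : JetField k n m} (ha : a ∈ diffAdjoin S) :
    sharp η a = 0 := by
  obtain ⟨-, φ, hφ, hfix⟩ := hη
  refine IntermediateField.adjoin_induction k (p := fun x _ => sharp η x = 0)
    ?_ ?_ ?_ ?_ ?_ ha
  · rintro x ⟨s, hs, μ, rfl⟩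
    have h := congrArg TrivSqZeroExt.snd (hfix s hs μ)
    rw [algHom_eq_firstOrder η φ hφ] at h
    exact h
  · intro x
    exact Derivation.map_algebraMap _ x
  · intro x y _ _ hx hy
    rw [map_add, hx, hy, add_zero]
  · intro x _ hx
    rw [Derivation.leibniz_inv, hx, smul_zero]
  · intro x y _ _ hx hy
    rw [Derivation.leibniz, hx, hy, smul_zero, smul_zero, add_zero]

/-- A derivation commuting with `♯(η)` preserves the elements killed by `♯(η)`. -/
theorem sharp_reciprocal_eq_zero {R : Set (TargetSection k n m)} {q : ℕ∞}
    {δ : Derivation k (level k n m q) (level k n m q)} (hδ : δ ∈ reciprocal R q)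
    {η : TargetSection k n m} (hη : η ∈ R) {a : level k n m q}
    (ha : sharp η (a : JetField k n m) = 0) : sharp η (δ a : JetField k n m) = 0 := by
  have h := DFunLike.congr_fun (hδ η hη) a
  have ha' : sharpAt q η a = 0 := Subtype.ext ha
  rw [Derivation.commutator_apply, ha', map_zero, sub_zero] at h
  exact congrArg Subtype.val h

end JetGalois

theorem proposition4p21 {k : Type*} [Field k] [CharZero k] (n m : ℕ)
    (Φ Ψ : Set (JetGalois.JetField k n m)) :
    (∀ (A : Type _) [CommRing A] [Algebra k A] [Algebra (JetGalois.JetField k n m) A]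
        [IsScalarTower k (JetGalois.JetField k n m) A],
      JetGalois.pseudogroup (Φ ∪ Ψ) A ⊆ JetGalois.pseudogroup Φ A) ∧
    (∀ q : ℕ∞, ∀ δ ∈ JetGalois.reciprocal (JetGalois.infinitesimal Φ) q,
      ∀ a : JetGalois.level k n m q,
        (a : JetGalois.JetField k n m) ∈ JetGalois.diffAdjoin (Φ ∪ Ψ) →
        (δ a : JetGalois.JetField k n m) ∈
          JetGalois.invariants (JetGalois.infinitesimal (Φ ∪ Ψ))) ∧
    (∀ R ⊆ JetGalois.infinitesimal Φ,
      (JetGalois.diffAdjoin (Φ ∪ Ψ) : Set (JetGalois.JetField k n m)) =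
        JetGalois.invariants R →
      JetGalois.IsStable (JetGalois.infinitesimal Φ) (JetGalois.diffAdjoin (Φ ∪ Ψ))) := by
  refine ⟨fun A _ _ _ _ => JetGalois.pseudogroup_anti Set.subset_union_left A,
    fun q δ hδ a ha η hη => ?_, fun R hR hK q δ hδ a ha => ?_⟩
  · exact JetGalois.sharp_reciprocal_eq_zero hδ
      (JetGalois.infinitesimal_anti Set.subset_union_left hη)
      (JetGalois.sharp_eq_zero_of_mem_diffAdjoin hη ha)
  · rw [← SetLike.mem_coe, hK] at ha ⊢
    exact fun η hη => JetGalois.sharp_reciprocal_eq_zero hδ (hR hη) (ha η hη)
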